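/- A variety of groups is the class of all groups satisfying a given set of laws. For a variety $\mathcal M$ and the variety $\mathcal A$ of abelian groups, $\mathcal{MA}$ denotes the class of all groups $H$ that have a normal subgroup $N\in\mathcal M$ with $H/N\in\mathcal A$. A group is $4$-generated if it can be generated by $4$ elements (not necessarily distinct). The derived length of a solvable group $G$ is the least $n\ge 0$ with $G^{(n)}=1$. Let $\mathcal M$ be an arbitrary variety of groups. 1. Let $G\in\mathcal M$ be a (finite or infinite) countable group whose abelianization $G/G'$ is a direct product of a free abelian group and a finite group. Then $G$ embeds in a $4$-generated group $H\in\mathcal{MA}$. In particular, every finitely generated group $G\in\mathcal M$ embeds in some $4$-generated group $H\in\mathcal{MA}$. 2. Let $G$ be a countable solvable group of derived length $l$ whose abelianization $G/G'$ is a direct product of a free abelian group and a finite group. Then $G$ embeds in a $4$-generated solvable group $H$ of derived length $l+1$. In particular, every finitely generated solvable group $G$ of derived length $l$ embeds in some $4$-generated solvable group $H$ of derived length $l+1$. -/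

import Mathlib

universe u v

/-- A variety of groups, presented by a set of laws: words in countably many variables. -/
structure GroupVariety where
  /-- the defining laws -/
  laws : Set (FreeGroup ℕ)

namespace GroupVariety

/-- `G` lies in the variety `M`: every law of `M` takes the value `1` under every substitution
of elements of `G` for the variables. -/
def Contains (M : GroupVariety) (G : Type u) [Group G] : Prop :=
  ∀ w ∈ M.laws, ∀ f : ℕ → G, FreeGroup.lift f w = 1

/-- The variety of abelian groups, defined by the law `[x₀, x₁] = 1`. -/
def abelian : GroupVariety where
  laws := {FreeGroup.of 0 * FreeGroup.of 1 * (FreeGroup.of 0)⁻¹ * (FreeGroup.of 1)⁻¹}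

/-- `H` lies in the product variety `M N`: it is an extension of a group in `M` (the normal
subgroup) by a group in `N` (the quotient). -/
def ProductContains (M N : GroupVariety) (H : Type u) [Group H] : Prop :=
  ∃ (K : Subgroup H) (_ : K.Normal), M.Contains K ∧ N.Contains (H ⧸ K)

theorem contains_abelian_iff (G : Type u) [Group G] :
    abelian.Contains G ↔ ∀ a b : G, a * b = b * a := by
  constructor
  · intro h a b
    have h1 := h _ rfl (fun n => if n = 0 then a else b)
    simpa [mul_inv_eq_one, mul_inv_eq_iff_eq_mul] using h1
  · rintro h w rfl f
    simpa [mul_inv_eq_one, mul_inv_eq_iff_eq_mul] using h (f 0) (f 1)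

end GroupVariety

/-- `G` can be generated by `k` elements (repetitions allowed). -/
def IsGeneratedByCard (k : ℕ) (G : Type u) [Group G] : Prop :=
  ∃ x : Fin k → G, Subgroup.closure (Set.range x) = ⊤

/-- `G` is isomorphic to a subgroup of `H`. -/
def GroupEmbeds (G : Type u) (H : Type v) [Group G] [Group H] : Prop :=
  ∃ φ : G →* H, Function.Injective φ

/-- The abelianization of `G` is a direct product of a free abelian group (of arbitrary rank,
possibly `0` or infinite) and a finite group. -/
def AbelianizationIsFreeTimesFinite (G : Type u) [Group G] : Prop :=
  ∃ (ι T : Type u) (_ : Group T) (_ : Finite T),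
    Nonempty (Abelianization G ≃* Multiplicative (ι →₀ ℤ) × T)

/-- `G` is solvable of derived length exactly `l`: `l` is the least `n` for which the `n`-th term
of the derived series is trivial. -/
def HasDerivedLength (G : Type u) [Group G] (l : ℕ) : Prop :=
  IsLeast {n : ℕ | derivedSeries G n = ⊥} l

/-!
Every group required here is found inside the unrestricted wreath product `G Wr ℤ³`, that is
`(ℤ³ → G) ⋊ ℤ³` with `ℤ³` acting by translations. A subgroup of it meets the base in a subgroup of a
power of `G`, which satisfies the laws of `G` and has at most its derived length, and the quotient is
abelian. Only one function `f : ℤ³ → G` is adjoined to the three translations, so everything rests on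
the choice of `f` (`seed`).

Let `d₀, …, d_{r-1}` and `c i` (`i : ι`) generate `G` modulo `G'`, the `c i` being a basis of a free
abelian direct factor of `G / G'`. The function `f` lives on planes `z = n p`, where `p` ranges over
`Fin r ⊕ G` and the integers `n p` form a Sidon set: on the plane of `g : G` it is constantly `g`, on
the plane of `j : Fin r` it is `d j ^ (choose x j * choose y (r - j))`. The image of `G` is assembled
from the following elements (`latticeEmbedding_mem`).

* Translate `f` vertically by `n p` and by `n q`, `p ≠ q`: by the Sidon property the supports of the
  two translates share only the plane `z = 0`, so the commutators of translates yield `[g, g']` placed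
  on that plane, for all `g`, `g'` in `G`.
* Iterated commutators of `f` with the horizontal translations are iterated differences in each
  exponent. Taking `j` differences in `x` and `r - j` in `y` annihilates the constants and all the
  monomials but the `j`-th, which becomes `1`; this isolates `d j` on a single plane. Two horizontal
  directions provide room for any number of monomials of the same degree, which is why four
  generators suffice for all `r`.
* For `c i` the translate of `f` with value `c i` on `z = 0` is used. Off that plane it takes unwanted
  values, but at each point this happens for at most one `i`, and since the `i`-th coordinate is a
  homomorphism `G → ℤ`, the powers of the unwanted value still define a homomorphism.

The homomorphism so obtained is the identity in the coordinate `0` and trivial in the coordinate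
`(0, 0, 1)`, because the `n p` are odd. Hence the commutators of its values with the vertical
translation project onto `G` in the coordinate `0`, and the derived length goes up by exactly one.
-/

open scoped commutatorElement

namespace LatticeWreath

/-! ### The wreath product with `ℤ³` and its subgroups generated by the lattice and a function -/

section Wreath

variable {G : Type u} [Group G]

/-- The action of `ℤ³` on the functions `ℤ³ → G` by translating the argument. -/
def translation (G : Type u) [Group G] :
    Multiplicative (ℤ × ℤ × ℤ) →* MulAut (ℤ × ℤ × ℤ → G) where
  toFun a :=
    { toFun := fun F ω => F (ω + a.toAdd)
      invFun := fun F ω => F (ω - a.toAdd)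
      left_inv := fun F => by funext ω; simp
      right_inv := fun F => by funext ω; simp
      map_mul' := fun _ _ => rfl }
  map_one' := by ext F ω; simp
  map_mul' a b := by
    ext F ω
    simp [add_assoc, add_comm a.toAdd]

@[simp]
theorem translation_apply (a : Multiplicative (ℤ × ℤ × ℤ)) (F : ℤ × ℤ × ℤ → G) (ω : ℤ × ℤ × ℤ) :
    translation G a F ω = F (ω + a.toAdd) := rfl

/-- The subgroup of the unrestricted wreath product `G Wr ℤ³` generated by the three unit
translations and one function of the base. -/
def latticeSubgroup (f : ℤ × ℤ × ℤ → G) :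
    Subgroup ((ℤ × ℤ × ℤ → G) ⋊[translation G] Multiplicative (ℤ × ℤ × ℤ)) :=
  Subgroup.closure (Set.range
    ![SemidirectProduct.inl f, SemidirectProduct.inr (Multiplicative.ofAdd (1, 0, 0)),
      SemidirectProduct.inr (Multiplicative.ofAdd (0, 1, 0)),
      SemidirectProduct.inr (Multiplicative.ofAdd (0, 0, 1))])

theorem isGeneratedByCard_closure {H : Type u} [Group H] {k : ℕ} (x : Fin k → H) :
    IsGeneratedByCard k (Subgroup.closure (Set.range x)) := by
  refine ⟨fun i => ⟨x i, Subgroup.subset_closure ⟨i, rfl⟩⟩, ?_⟩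
  rw [← Subgroup.closure_closure_coe_preimage (k := Set.range x)]
  congr 1
  ext y
  simp [Subtype.ext_iff]

theorem isGeneratedByCard_latticeSubgroup (f : ℤ × ℤ × ℤ → G) :
    IsGeneratedByCard 4 (latticeSubgroup f) :=
  isGeneratedByCard_closure _

theorem inl_mem_latticeSubgroup (f : ℤ × ℤ × ℤ → G) :
    SemidirectProduct.inl f ∈ latticeSubgroup f :=
  Subgroup.subset_closure ⟨0, rfl⟩

theorem inr_mem_latticeSubgroup (f : ℤ × ℤ × ℤ → G) (a : Multiplicative (ℤ × ℤ × ℤ)) :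
    SemidirectProduct.inr a ∈ latticeSubgroup f := by
  have h (k : Fin 4) := Subgroup.subset_closure (k := Set.range
    ![SemidirectProduct.inl f, SemidirectProduct.inr (Multiplicative.ofAdd (1, 0, 0)),
      SemidirectProduct.inr (Multiplicative.ofAdd (0, 1, 0)),
      (SemidirectProduct.inr (Multiplicative.ofAdd (0, 0, 1)) :
        (ℤ × ℤ × ℤ → G) ⋊[translation G] Multiplicative (ℤ × ℤ × ℤ))]) ⟨k, rfl⟩
  have ha : a = Multiplicative.ofAdd (1, 0, 0) ^ a.toAdd.1 *
      (Multiplicative.ofAdd (0, 1, 0) ^ a.toAdd.2.1 *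
        Multiplicative.ofAdd (0, 0, 1) ^ a.toAdd.2.2) := by
    apply Multiplicative.toAdd.injective
    ext <;> simp
  rw [ha]
  simp only [map_mul, map_zpow]
  exact mul_mem (zpow_mem (h 1) _) (mul_mem (zpow_mem (h 2) _) (zpow_mem (h 3) _))

theorem translation_mem (f : ℤ × ℤ × ℤ → G) {F : ℤ × ℤ × ℤ → G}
    (hF : SemidirectProduct.inl F ∈ latticeSubgroup f) (a : Multiplicative (ℤ × ℤ × ℤ)) :
    SemidirectProduct.inl (translation G a F) ∈ latticeSubgroup f := by
  rw [SemidirectProduct.inl_aut]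
  exact mul_mem (mul_mem (inr_mem_latticeSubgroup f a) hF) (inr_mem_latticeSubgroup f _)

/-- The projection of a subgroup of `G Wr ℤ³` onto the lattice; its kernel is the intersection of
the subgroup with the base. -/
def toLattice (H : Subgroup ((ℤ × ℤ × ℤ → G) ⋊[translation G] Multiplicative (ℤ × ℤ × ℤ))) :
    H →* Multiplicative (ℤ × ℤ × ℤ) :=
  SemidirectProduct.rightHom.comp H.subtype

/-- Evaluation at `ω` of the elements that lie in the base. -/
def evalBase (H : Subgroup ((ℤ × ℤ × ℤ → G) ⋊[translation G] Multiplicative (ℤ × ℤ × ℤ)))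
    (ω : ℤ × ℤ × ℤ) : (toLattice H).ker →* G where
  toFun x := x.1.1.left ω
  map_one' := rfl
  map_mul' x y := by
    have hx : x.1.1.right = 1 := x.2
    simp [hx]

theorem eq_one_of_evalBase
    {H : Subgroup ((ℤ × ℤ × ℤ → G) ⋊[translation G] Multiplicative (ℤ × ℤ × ℤ))}
    {x : (toLattice H).ker} (h : ∀ ω, evalBase H ω x = 1) : x = 1 := by
  apply Subtype.ext
  apply Subtype.ext
  exact SemidirectProduct.ext (funext h) x.2

theorem contains_ker {M : GroupVariety} (hG : M.Contains G)
    (H : Subgroup ((ℤ × ℤ × ℤ → G) ⋊[translation G] Multiplicative (ℤ × ℤ × ℤ))) :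
    M.Contains (toLattice H).ker := by
  intro w hw σ
  refine eq_one_of_evalBase fun ω => ?_
  rw [← hG w hw fun i => evalBase H ω (σ i)]
  have h : (evalBase H ω).comp (FreeGroup.lift σ) =
      FreeGroup.lift fun i => evalBase H ω (σ i) := by
    ext i
    simp
  exact DFunLike.congr_fun h w

theorem productContains {M : GroupVariety} (hG : M.Contains G)
    (H : Subgroup ((ℤ × ℤ × ℤ → G) ⋊[translation G] Multiplicative (ℤ × ℤ × ℤ))) :
    M.ProductContains GroupVariety.abelian H := by
  refine ⟨(toLattice H).ker, inferInstance, contains_ker hG H, ?_⟩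
  rw [GroupVariety.contains_abelian_iff]
  intro a b
  apply QuotientGroup.kerLift_injective (toLattice H)
  simp only [map_mul, mul_comm]

end Wreath

/-! ### Derived length -/

section DerivedLength

theorem derivedSeries_succ_eq_map (H : Type u) [Group H] (n : ℕ) :
    derivedSeries H (n + 1) = (derivedSeries (commutator H) n).map (commutator H).subtype := by
  induction n with
  | zero =>
    rw [derivedSeries_one, derivedSeries_zero, ← MonoidHom.range_eq_map, Subgroup.range_subtype]
  | succ n ih => rw [derivedSeries_succ, ih, derivedSeries_succ, Subgroup.map_commutator]

theorem derivedSeries_succ_le_map {H : Type u} [Group H] {N : Subgroup H} (hN : commutator H ≤ N)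
    (n : ℕ) : derivedSeries H (n + 1) ≤ (derivedSeries N n).map N.subtype := by
  induction n with
  | zero =>
    rw [derivedSeries_one, derivedSeries_zero, ← MonoidHom.range_eq_map, Subgroup.range_subtype]
    exact hN
  | succ n ih =>
    rw [derivedSeries_succ, derivedSeries_succ N, Subgroup.map_commutator]
    exact Subgroup.commutator_mono ih ih

variable {G : Type u} [Group G]

theorem commutator_le_ker_toLattice
    (H : Subgroup ((ℤ × ℤ × ℤ → G) ⋊[translation G] Multiplicative (ℤ × ℤ × ℤ))) :
    commutator H ≤ (toLattice H).ker :=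
  Abelianization.commutator_subset_ker _

theorem derivedSeries_succ_eq_bot {l : ℕ} (hG : derivedSeries G l = ⊥)
    (H : Subgroup ((ℤ × ℤ × ℤ → G) ⋊[translation G] Multiplicative (ℤ × ℤ × ℤ))) :
    derivedSeries H (l + 1) = ⊥ := by
  have hN : derivedSeries (toLattice H).ker l = ⊥ := by
    rw [eq_bot_iff]
    intro x hx
    refine eq_one_of_evalBase fun ω => ?_
    have := map_derivedSeries_le_derivedSeries (evalBase H ω) l (Subgroup.mem_map_of_mem _ hx)
    rwa [hG] at this
  have := derivedSeries_succ_le_map (commutator_le_ker_toLattice H) l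
  rwa [hN, Subgroup.map_bot, le_bot_iff] at this

/-- A copy of `G` in the base that is visible in the coordinate `0` but not in `(0, 0, 1)` forces the
derived subgroup to project onto `G`: the commutator of `ψ g⁻¹` with the vertical translation has the
value `g` at `0`. -/
theorem hasDerivedLength_latticeSubgroup {l : ℕ} (hG : HasDerivedLength G l)
    {f : ℤ × ℤ × ℤ → G} {ψ : G →* (ℤ × ℤ × ℤ → G)}
    (h0 : ∀ g, ψ g 0 = g) (h1 : ∀ g, ψ g (0, 0, 1) = 1)
    (hψ : ∀ g, SemidirectProduct.inl (ψ g) ∈ latticeSubgroup f) :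
    HasDerivedLength (latticeSubgroup f) (l + 1) := by
  refine ⟨derivedSeries_succ_eq_bot hG.1 _, fun n hn => ?_⟩
  let u : latticeSubgroup f := ⟨_, inr_mem_latticeSubgroup f (Multiplicative.ofAdd (0, 0, 1))⟩
  cases n with
  | zero =>
    have hu : u ∈ derivedSeries (latticeSubgroup f) 0 := Subgroup.mem_top u
    rw [hn, Subgroup.mem_bot] at hu
    have h := congrArg (toLattice (latticeSubgroup f)) hu
    have h' : ((0, 0, 1) : ℤ × ℤ × ℤ) = 0 := congrArg Multiplicative.toAdd h
    simp at h'
  | succ n =>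
    refine Nat.succ_le_succ (hG.2 ?_)
    let θ : commutator (latticeSubgroup f) →* G :=
      (evalBase _ 0).comp (Subgroup.inclusion (commutator_le_ker_toLattice (latticeSubgroup f)))
    have hθ : Function.Surjective θ := by
      intro g
      let y : latticeSubgroup f := ⟨_, hψ g⁻¹⟩
      have hy : ⁅u, y⁆ ∈ commutator (latticeSubgroup f) :=
        Subgroup.commutator_mem_commutator (Subgroup.mem_top u) (Subgroup.mem_top y)
      refine ⟨⟨⁅u, y⁆, hy⟩, ?_⟩
      have hval : ((⁅u, y⁆ : latticeSubgroup f) :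
          (ℤ × ℤ × ℤ → G) ⋊[translation G] Multiplicative (ℤ × ℤ × ℤ)) =
          SemidirectProduct.inl
            (translation G (Multiplicative.ofAdd (0, 0, 1)) (ψ g⁻¹) * (ψ g⁻¹)⁻¹) := by
        rw [map_mul, map_inv SemidirectProduct.inl, SemidirectProduct.inl_aut,
          map_inv SemidirectProduct.inr]
        rfl
      change (⁅u, y⁆ : latticeSubgroup f).1.left 0 = g
      rw [hval]
      simp [h0, h1]
    have hbot : derivedSeries (commutator (latticeSubgroup f)) n = ⊥ := by
      have h : derivedSeries (latticeSubgroup f) (n + 1) = ⊥ := hn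
      rwa [derivedSeries_succ_eq_map,
        Subgroup.map_eq_bot_iff_of_injective _ (Subgroup.subtype_injective _)] at h
    change derivedSeries G n = ⊥
    rw [← map_derivedSeries_eq hθ n, hbot, Subgroup.map_bot]

end DerivedLength

/-! ### Sidon sets and binomial coefficients -/

theorem pow_three_sidon {i j k l : ℕ} (hij : i ≠ j) (h : (3 : ℤ) ^ i - 3 ^ j = 3 ^ k - 3 ^ l) :
    i = k := by
  have hpos (a : ℕ) : (0 : ℤ) < 3 ^ a := by positivity
  have hlt {a b : ℕ} (hab : a < b) : (3 : ℤ) * 3 ^ a ≤ 3 ^ b := by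
    rw [← pow_succ']
    exact pow_le_pow_right₀ (by norm_num) hab
  by_contra hik
  have hlj : l ≠ j := by
    rintro rfl
    exact hik (pow_right_injective₀ (a := (3 : ℤ)) (by norm_num) (by norm_num) (by simpa using h))
  have hkl : k ≠ l := by
    rintro rfl
    exact hij (pow_right_injective₀ (a := (3 : ℤ)) (by norm_num) (by norm_num) (by simpa [sub_eq_zero] using h))
  have := hpos i
  have := hpos j
  have := hpos k
  have := hpos l
  -- In `3 ^ i + 3 ^ l = 3 ^ k + 3 ^ j` the largest power exceeds the sum of the other side.
  rcases lt_or_gt_of_ne hik with h1 | h1 <;> rcases lt_or_gt_of_ne hij with h2 | h2 <;>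
    rcases lt_or_gt_of_ne hlj with h3 | h3 <;> rcases lt_or_gt_of_ne hkl with h4 | h4 <;>
    have := hlt h1 <;> have := hlt h2 <;> have := hlt h3 <;> have := hlt h4 <;> omega

/-- Every countable type indexes a Sidon set of odd integers. -/
theorem exists_odd_sidon (P : Type u) [Countable P] :
    ∃ n : P → ℤ, (∀ p, Odd (n p)) ∧ Function.Injective n ∧
      ∀ p q p' q', p ≠ q → n p - n q = n p' - n q' → p = p' := by
  obtain ⟨e, he⟩ := exists_injective_nat P
  refine ⟨fun p => 3 ^ e p, fun p => Odd.pow (by decide), fun p q h => ?_, fun p q p' q' hpq h => ?_⟩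
  · exact he (pow_right_injective₀ (a := (3 : ℤ)) (by norm_num) (by norm_num) h)
  · exact he (pow_three_sidon (he.ne hpq) h)

/-- The binomial coefficient `x` over `k` as a function on `ℤ`, with value `0` for `k < 0`, so that
the difference in `x` lowers `k` by one for every `k`. -/
def binom (k x : ℤ) : ℤ := if 0 ≤ k then Ring.choose x k.toNat else 0

theorem binom_zero (x : ℤ) : binom 0 x = 1 := by simp [binom]

theorem binom_of_neg {k : ℤ} (hk : k < 0) (x : ℤ) : binom k x = 0 := if_neg hk.not_ge

theorem binom_add_one_sub (k x : ℤ) : binom k (x + 1) - binom k x = binom (k - 1) x := by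
  rcases lt_trichotomy k 0 with hk | rfl | hk
  · rw [binom_of_neg hk, binom_of_neg hk, binom_of_neg (by omega), sub_zero]
  · rw [binom_zero, binom_zero, binom_of_neg (by omega), sub_self]
  · obtain ⟨m, rfl⟩ : ∃ m : ℕ, k = m + 1 := ⟨(k - 1).toNat, by omega⟩
    have h1 : (0 : ℤ) ≤ m + 1 := by omega
    have h2 : ((m : ℤ) + 1).toNat = m + 1 := by omega
    simp [binom, h1, h2, Ring.choose_succ_succ]

/-! ### The function adjoined to the lattice -/

section Seed

variable {G : Type u} [Group G] {r : ℕ}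

/-- The `a`-fold difference in `x` and `b`-fold difference in `y` of the function `seed n d 0 0`,
which is supported on the planes `z = n p` and takes there the values `g` for `p = g : G` and
`d j ^ (binom j x * binom (r - j) y)` for `p = j : Fin r`. -/
noncomputable def seed (n : Fin r ⊕ G → ℤ) (d : Fin r → G) (a b : ℤ) : ℤ × ℤ × ℤ → G :=
  fun ω => Function.extend n
    (fun p => Sum.elim d id p ^
      (binom (Sum.elim (fun j : Fin r => (j : ℤ)) 0 p - a) ω.1 *
        binom (Sum.elim (fun j : Fin r => (r : ℤ) - j) 0 p - b) ω.2.1)) 1 ω.2.2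

variable {n : Fin r ⊕ G → ℤ} {d : Fin r → G}

theorem seed_apply (hn : Function.Injective n) (a b x y : ℤ) (p : Fin r ⊕ G) :
    seed n d a b (x, y, n p) = Sum.elim d id p ^
      (binom (Sum.elim (fun j : Fin r => (j : ℤ)) 0 p - a) x *
        binom (Sum.elim (fun j : Fin r => (r : ℤ) - j) 0 p - b) y) :=
  hn.extend_apply _ _ _

theorem seed_apply_inr (hn : Function.Injective n) (x y : ℤ) (g : G) :
    seed n d 0 0 (x, y, n (Sum.inr g)) = g := by
  simp [seed_apply hn, binom_zero]

theorem seed_eq_one {a b x y z : ℤ} (hz : ¬∃ p, n p = z) : seed n d a b (x, y, z) = 1 :=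
  Function.extend_apply' _ _ _ hz

theorem seed_add_one_left (hn : Function.Injective n) (a b : ℤ) :
    translation G (Multiplicative.ofAdd (1, 0, 0)) (seed n d a b) * (seed n d a b)⁻¹ =
      seed n d (a + 1) b := by
  funext ⟨x, y, z⟩
  by_cases hz : ∃ p, n p = z
  · obtain ⟨p, rfl⟩ := hz
    simp only [Pi.mul_apply, Pi.inv_apply, translation_apply, toAdd_ofAdd, Prod.mk_add_mk, add_zero,
      seed_apply hn]
    rw [← zpow_neg, ← zpow_add, ← sub_sub, ← binom_add_one_sub]
    congr 1
    ring
  · simp [seed_eq_one hz]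

theorem seed_add_one_right (hn : Function.Injective n) (a b : ℤ) :
    translation G (Multiplicative.ofAdd (0, 1, 0)) (seed n d a b) * (seed n d a b)⁻¹ =
      seed n d a (b + 1) := by
  funext ⟨x, y, z⟩
  by_cases hz : ∃ p, n p = z
  · obtain ⟨p, rfl⟩ := hz
    simp only [Pi.mul_apply, Pi.inv_apply, translation_apply, toAdd_ofAdd, Prod.mk_add_mk, add_zero,
      seed_apply hn]
    rw [← zpow_neg, ← zpow_add, ← sub_sub, ← binom_add_one_sub]
    congr 1
    ring
  · simp [seed_eq_one hz]

theorem seed_mem (hn : Function.Injective n) (a b : ℕ) :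
    SemidirectProduct.inl (seed n d a b) ∈ latticeSubgroup (seed n d 0 0) := by
  induction a with
  | zero =>
    induction b with
    | zero => exact inl_mem_latticeSubgroup _
    | succ b ih =>
      rw [Nat.cast_succ, ← seed_add_one_right hn, map_mul, map_inv]
      exact mul_mem (translation_mem _ ih _) (inv_mem ih)
  | succ a ih =>
    rw [Nat.cast_succ, ← seed_add_one_left hn, map_mul, map_inv]
    exact mul_mem (translation_mem _ ih _) (inv_mem ih)

/-- Taking `j` differences in `x` and `r - j` in `y` isolates `d j`. -/
theorem seed_isolate (hn : Function.Injective n) (j : Fin r) (x y z : ℤ) :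
    seed n d j ((r : ℤ) - j) (x, y, z) = if z = n (Sum.inl j) then d j else 1 := by
  by_cases hz : ∃ p, n p = z
  · obtain ⟨p, rfl⟩ := hz
    rw [seed_apply hn]
    rcases p with i | g
    · by_cases hij : i = j
      · subst hij
        simp [binom_zero]
      · rw [if_neg fun h => hij (Sum.inl_injective (hn h))]
        have hne : (i : ℕ) ≠ j := fun h => hij (Fin.ext h)
        rcases lt_or_gt_of_ne hne with h | h
        · simp only [Sum.elim_inl]
          rw [binom_of_neg (k := (i : ℤ) - j) (by omega), zero_mul, zpow_zero]
        · simp only [Sum.elim_inl]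
          rw [binom_of_neg (k := (r : ℤ) - i - (r - j)) (by omega), mul_zero, zpow_zero]
    · rw [if_neg fun h => Sum.inr_ne_inl (hn h)]
      -- Since `j < r`, at least one difference in `y` is taken, so the constants vanish.
      have := j.2
      simp only [Sum.elim_inr, Pi.zero_apply]
      rw [binom_of_neg (k := 0 - ((r : ℤ) - j)) (by omega), mul_zero, zpow_zero]
  · rw [seed_eq_one hz, if_neg]
    rintro rfl
    exact hz ⟨_, rfl⟩

end Seed

/-! ### The embedding -/

section Embedding

variable {G : Type u} [Group G] {r : ℕ} {ι : Type v}

open scoped Classical in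
/-- The embedding of `G` into the base: the identity at the points with `z = 0`; at any other point
`ω`, if the vertical translate of `f` that takes the value `c i` on `z = 0` is nontrivial at `ω` for
some `i`, the powers of its value there with exponent the `i`-th coordinate `χ i`. -/
noncomputable def latticeEmbedding (n : Fin r ⊕ G → ℤ) (f : ℤ × ℤ × ℤ → G) (c : ι → G)
    (χ : ι → G →* Multiplicative ℤ) : G →* (ℤ × ℤ × ℤ → G) :=
  MonoidHom.pi fun ω =>
    if ω.2.2 = 0 then MonoidHom.id G
    else if h : ∃ i, f (ω + (0, 0, n (Sum.inr (c i)))) ≠ 1 then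
      (zpowersHom G (f (ω + (0, 0, n (Sum.inr (c h.choose)))))).comp (χ h.choose)
    else 1

variable {n : Fin r ⊕ G → ℤ} {f : ℤ × ℤ × ℤ → G} {c : ι → G} {χ : ι → G →* Multiplicative ℤ}

theorem latticeEmbedding_plane {ω : ℤ × ℤ × ℤ} (hω : ω.2.2 = 0) (g : G) :
    latticeEmbedding n f c χ g ω = g := by
  simp [latticeEmbedding, hω]

theorem latticeEmbedding_of_coord_eq_one {ω : ℤ × ℤ × ℤ} (hω : ω.2.2 ≠ 0) {g : G}
    (hg : ∀ i, χ i g = 1) : latticeEmbedding n f c χ g ω = 1 := by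
  simp only [latticeEmbedding, MonoidHom.pi_apply, if_neg hω]
  split_ifs with h
  · simp [hg]
  · rfl

theorem latticeEmbedding_of_forall_eq_one {ω : ℤ × ℤ × ℤ} (hω : ω.2.2 ≠ 0)
    (h : ∀ i, f (ω + (0, 0, n (Sum.inr (c i)))) = 1) (g : G) :
    latticeEmbedding n f c χ g ω = 1 := by
  simp only [latticeEmbedding, MonoidHom.pi_apply, if_neg hω]
  rw [dif_neg (by simpa using h)]
  rfl

variable {d : Fin r → G}

/-- Where two vertical translates of the seed are both nontrivial, `z = 0`. -/
theorem seed_translates_disjoint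
    (hsidon : ∀ p q p' q', p ≠ q → n p - n q = n p' - n q' → p = p')
    {p q : Fin r ⊕ G} (hpq : p ≠ q) {ω : ℤ × ℤ × ℤ}
    (hp : seed n d 0 0 (ω + (0, 0, n p)) ≠ 1) (hq : seed n d 0 0 (ω + (0, 0, n q)) ≠ 1) :
    ω.2.2 = 0 := by
  obtain ⟨x, y, z⟩ := ω
  simp only [Prod.mk_add_mk, add_zero] at hp hq ⊢
  obtain ⟨p', hp'⟩ : ∃ p', n p' = z + n p := by
    by_contra h
    exact hp (seed_eq_one h)
  obtain ⟨q', hq'⟩ : ∃ q', n q' = z + n q := by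
    by_contra h
    exact hq (seed_eq_one h)
  have := hsidon p q p' q' hpq (by omega)
  subst this
  omega

/-- The image of `G` lies in the subgroup: this holds for `G'`, for the `d j` and for the `c i`. -/
theorem latticeEmbedding_mem (hn : Function.Injective n)
    (hsidon : ∀ p q p' q', p ≠ q → n p - n q = n p' - n q' → p = p')
    (hd : ∀ i j, χ i (d j) = 1) (hc : ∀ i, χ i (c i) = Multiplicative.ofAdd 1)
    (hc' : ∀ i j, i ≠ j → χ i (c j) = 1)
    (hgen : Subgroup.closure (Set.range d ∪ Set.range c) ⊔ commutator G = ⊤) (g : G) :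
    SemidirectProduct.inl (latticeEmbedding n (seed n d 0 0) c χ g) ∈
      latticeSubgroup (seed n d 0 0) := by
  have hcinj : Function.Injective c := by
    intro i j hij
    by_contra hne
    have h := hc i
    rw [hij, hc' i j hne] at h
    exact absurd (congrArg Multiplicative.toAdd h) (by simp)
  have htr (p : Fin r ⊕ G) := translation_mem _ (inl_mem_latticeSubgroup (seed n d 0 0))
    (Multiplicative.ofAdd (0, 0, n p))
  suffices h : ⊤ ≤ (latticeSubgroup (seed n d 0 0)).comap
      (SemidirectProduct.inl.comp (latticeEmbedding n (seed n d 0 0) c χ)) from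
    h (Subgroup.mem_top g)
  rw [← hgen, sup_le_iff, Subgroup.closure_le, Set.union_subset_iff]
  refine ⟨⟨?_, ?_⟩, ?_⟩
  · rintro _ ⟨j, rfl⟩
    have h : latticeEmbedding n (seed n d 0 0) c χ (d j) =
        translation G (Multiplicative.ofAdd (0, 0, n (Sum.inl j)))
          (seed n d j ((r : ℤ) - j)) := by
      funext ⟨x, y, z⟩
      by_cases hz : z = 0
      · rw [latticeEmbedding_plane hz]
        simp [seed_isolate hn, hz]
      · rw [latticeEmbedding_of_coord_eq_one hz fun i => hd i j]
        simp [seed_isolate hn, hz]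
    have hmem := seed_mem (d := d) hn j (r - j)
    rw [Nat.cast_sub j.2.le] at hmem
    rw [SetLike.mem_coe, Subgroup.mem_comap, MonoidHom.comp_apply, h]
    exact translation_mem _ hmem _
  · rintro _ ⟨i, rfl⟩
    have h : latticeEmbedding n (seed n d 0 0) c χ (c i) =
        translation G (Multiplicative.ofAdd (0, 0, n (Sum.inr (c i)))) (seed n d 0 0) := by
      funext ω
      rw [translation_apply, toAdd_ofAdd]
      by_cases hz : ω.2.2 = 0
      · obtain ⟨x, y, z⟩ := ω
        rw [latticeEmbedding_plane hz]
        obtain rfl : z = 0 := hz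
        simp [seed_apply_inr hn]
      by_cases h : ∃ k, seed n d 0 0 (ω + (0, 0, n (Sum.inr (c k)))) ≠ 1
      · simp only [latticeEmbedding, MonoidHom.pi_apply, if_neg hz, dif_pos h]
        by_cases hi : h.choose = i
        · simp [hi, hc]
        · have h1 : seed n d 0 0 (ω + (0, 0, n (Sum.inr (c i)))) = 1 := by
            by_contra h1
            exact hz (seed_translates_disjoint hsidon
              (fun e => hi (hcinj (Sum.inr_injective e))) h.choose_spec h1)
          simp [hc' _ _ hi, h1]
      · push Not at h
        rw [latticeEmbedding_of_forall_eq_one hz h, h]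
    rw [SetLike.mem_coe, Subgroup.mem_comap, MonoidHom.comp_apply, h]
    exact htr _
  · rw [commutator_def, Subgroup.commutator_le]
    rintro a - b -
    have h : latticeEmbedding n (seed n d 0 0) c χ ⁅a, b⁆ =
        ⁅translation G (Multiplicative.ofAdd (0, 0, n (Sum.inr a))) (seed n d 0 0),
          translation G (Multiplicative.ofAdd (0, 0, n (Sum.inr b))) (seed n d 0 0)⁆ := by
      funext ω
      by_cases hz : ω.2.2 = 0
      · obtain ⟨x, y, z⟩ := ω
        rw [latticeEmbedding_plane hz]
        obtain rfl : z = 0 := hz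
        simp [commutatorElement_def, seed_apply_inr hn]
      · rw [latticeEmbedding_of_coord_eq_one hz fun i => by
          rw [map_commutatorElement, commutatorElement_eq_one_iff_mul_comm, mul_comm]]
        by_cases hab : a = b
        · simp [hab]
        · by_cases ha : seed n d 0 0 (ω + (0, 0, n (Sum.inr a))) = 1
          · simp [commutatorElement_def, ha]
          · have hb : seed n d 0 0 (ω + (0, 0, n (Sum.inr b))) = 1 := by
              by_contra hb
              exact hz (seed_translates_disjoint hsidon
                (fun e => hab (Sum.inr_injective e)) ha hb)
            simp [commutatorElement_def, hb]
    rw [Subgroup.mem_comap, MonoidHom.comp_apply, h, map_commutatorElement, commutatorElement_def]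
    exact mul_mem (mul_mem (mul_mem (htr _) (htr _)) (inv_mem (htr _))) (inv_mem (htr _))

/-- A countable group generated modulo its derived subgroup by finitely many `d j` together with
elements `c i` dual to homomorphisms `χ i` to `ℤ` that kill the `d j` embeds in the base of some
`latticeSubgroup`. -/
theorem exists_latticeEmbedding [Countable G] (d : Fin r → G) (c : ι → G)
    (χ : ι → G →* Multiplicative ℤ)
    (hd : ∀ i j, χ i (d j) = 1) (hc : ∀ i, χ i (c i) = Multiplicative.ofAdd 1)
    (hc' : ∀ i j, i ≠ j → χ i (c j) = 1)
    (hgen : Subgroup.closure (Set.range d ∪ Set.range c) ⊔ commutator G = ⊤) :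
    ∃ (f : ℤ × ℤ × ℤ → G) (ψ : G →* (ℤ × ℤ × ℤ → G)), (∀ g, ψ g 0 = g) ∧
      (∀ g, ψ g (0, 0, 1) = 1) ∧ ∀ g, SemidirectProduct.inl (ψ g) ∈ latticeSubgroup f := by
  obtain ⟨n, hodd, hn, hsidon⟩ := exists_odd_sidon (Fin r ⊕ G)
  refine ⟨seed n d 0 0, latticeEmbedding n (seed n d 0 0) c χ,
    fun g => latticeEmbedding_plane rfl g, fun g => ?_,
    latticeEmbedding_mem hn hsidon hd hc hc' hgen⟩
  refine latticeEmbedding_of_forall_eq_one one_ne_zero (fun i => ?_) g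
  -- The height `1 + n p` is even, so no plane of the support lies there.
  simp only [Prod.mk_add_mk, add_zero]
  refine seed_eq_one ?_
  rintro ⟨p, hp⟩
  obtain ⟨k, hk⟩ := hodd p
  obtain ⟨m, hm⟩ := hodd (Sum.inr (c i))
  omega

theorem groupEmbeds_latticeSubgroup {f : ℤ × ℤ × ℤ → G} {ψ : G →* (ℤ × ℤ × ℤ → G)}
    (h0 : ∀ g, ψ g 0 = g) (hψ : ∀ g, SemidirectProduct.inl (ψ g) ∈ latticeSubgroup f) :
    GroupEmbeds G (latticeSubgroup f) := by
  refine ⟨(SemidirectProduct.inl.comp ψ).codRestrict _ hψ, fun a b hab => ?_⟩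
  have h : ψ a = ψ b := SemidirectProduct.inl_injective (congrArg Subtype.val hab)
  rw [← h0 a, ← h0 b, h]

end Embedding

/-! ### Generators modulo the derived subgroup -/

variable {G : Type u} [Group G]

theorem countable_of_fg [hG : Group.FG G] : Countable G := by
  obtain ⟨S, hS⟩ := Group.fg_def.1 hG
  have hr : (FreeGroup.lift ((↑) : S → G)).range = ⊤ := by
    rw [FreeGroup.range_lift_eq_closure, Subtype.range_coe, ← hS]
  have : Countable (FreeGroup S) := Quot.mk_surjective.countable
  exact (MonoidHom.range_eq_top.1 hr).countable

theorem exists_latticeEmbedding_of_fg (hG : Group.FG G) :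
    ∃ (f : ℤ × ℤ × ℤ → G) (ψ : G →* (ℤ × ℤ × ℤ → G)), (∀ g, ψ g 0 = g) ∧
      (∀ g, ψ g (0, 0, 1) = 1) ∧ ∀ g, SemidirectProduct.inl (ψ g) ∈ latticeSubgroup f := by
  have := countable_of_fg (G := G)
  obtain ⟨S, hS⟩ := Group.fg_def.1 hG
  refine exists_latticeEmbedding (ι := Empty) (fun j => (S.equivFin.symm j : G)) Empty.elim
    Empty.rec (fun i => i.elim) (fun i => i.elim) (fun i => i.elim) ?_
  rw [eq_top_iff, ← hS]
  refine le_trans ((Subgroup.closure_le _).2 fun s hs => ?_) le_sup_left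
  exact Subgroup.subset_closure (Or.inl ⟨S.equivFin ⟨s, hs⟩, by simp⟩)

/-- The elements `c i` are lifts of a basis of the free abelian factor, and the `d j` lift all the
elements of the finite factor. -/
theorem exists_latticeEmbedding_of_abelianization [Countable G]
    (hG : AbelianizationIsFreeTimesFinite G) :
    ∃ (f : ℤ × ℤ × ℤ → G) (ψ : G →* (ℤ × ℤ × ℤ → G)), (∀ g, ψ g 0 = g) ∧
      (∀ g, ψ g (0, 0, 1) = 1) ∧ ∀ g, SemidirectProduct.inl (ψ g) ∈ latticeSubgroup f := by
  classical
  obtain ⟨ι, T, _, _, ⟨E⟩⟩ := hG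
  let q : G →* Multiplicative (ι →₀ ℤ) × T := E.toMonoidHom.comp Abelianization.of
  have hq : Function.Surjective q := E.surjective.comp QuotientGroup.mk_surjective
  have hker : q.ker = commutator G := by
    rw [← Abelianization.ker_of]
    ext x
    simp [q]
  choose s hs using hq
  let e := Finite.equivFin T
  let d : Fin (Nat.card T) → G := fun j => s (1, e.symm j)
  let c : ι → G := fun i => s (Multiplicative.ofAdd (Finsupp.single i 1), 1)
  let χ : ι → G →* Multiplicative ℤ := fun i =>
    (AddMonoidHom.toMultiplicative (Finsupp.applyAddHom i)).comp
      ((MonoidHom.fst (Multiplicative (ι →₀ ℤ)) T).comp q)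
  have hχ (i : ι) (x : Multiplicative (ι →₀ ℤ) × T) :
      χ i (s x) = Multiplicative.ofAdd (x.1.toAdd i) := by
    change Multiplicative.ofAdd ((q (s x)).1.toAdd i) = _
    rw [hs]
  refine exists_latticeEmbedding d c χ (fun i j => ?_) (fun i => ?_) (fun i j hij => ?_) ?_
  · simp [d, hχ]
  · simp [c, hχ]
  · simp [c, hχ, hij.symm]
  · rw [← hker, ← Subgroup.comap_map_eq, eq_top_iff]
    rintro g -
    rw [Subgroup.mem_comap, MonoidHom.map_closure]
    generalize q g = x
    obtain ⟨a, τ⟩ := x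
    have hτ : ((1, τ) : Multiplicative (ι →₀ ℤ) × T) ∈
        Subgroup.closure (q '' (Set.range d ∪ Set.range c)) :=
      Subgroup.subset_closure ⟨d (e τ), Or.inl ⟨_, rfl⟩, by simp [d, hs]⟩
    have ha (a : ι →₀ ℤ) : ((Multiplicative.ofAdd a, 1) : Multiplicative (ι →₀ ℤ) × T) ∈
        Subgroup.closure (q '' (Set.range d ∪ Set.range c)) := by
      induction a using Finsupp.induction_linear with
      | zero => exact one_mem _
      | add a b ha hb => simpa using mul_mem ha hb
      | single i k =>
        have hi : ((Multiplicative.ofAdd (Finsupp.single i 1), 1) :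
            Multiplicative (ι →₀ ℤ) × T) ∈
            Subgroup.closure (q '' (Set.range d ∪ Set.range c)) :=
          Subgroup.subset_closure ⟨c i, Or.inr ⟨_, rfl⟩, by simp [c, hs]⟩
        simpa [← ofAdd_zsmul] using zpow_mem hi k
    simpa using mul_mem (ha a.toAdd) hτ

end LatticeWreath

open LatticeWreath in
theorem corollary4 (M : GroupVariety) (l : ℕ) (G : Type u) [Group G] :
    (Countable G → M.Contains G → AbelianizationIsFreeTimesFinite G →
      ∃ (H : Type u) (_ : Group H), IsGeneratedByCard 4 H ∧
        M.ProductContains GroupVariety.abelian H ∧ GroupEmbeds G H) ∧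
    (Group.FG G → M.Contains G →
      ∃ (H : Type u) (_ : Group H), IsGeneratedByCard 4 H ∧
        M.ProductContains GroupVariety.abelian H ∧ GroupEmbeds G H) ∧
    (Countable G → HasDerivedLength G l → AbelianizationIsFreeTimesFinite G →
      ∃ (H : Type u) (_ : Group H), IsGeneratedByCard 4 H ∧
        HasDerivedLength H (l + 1) ∧ GroupEmbeds G H) ∧
    (Group.FG G → HasDerivedLength G l →
      ∃ (H : Type u) (_ : Group H), IsGeneratedByCard 4 H ∧
        HasDerivedLength H (l + 1) ∧ GroupEmbeds G H) := by
  have variety {G : Type u} [Group G] (hM : M.Contains G)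
      (h : ∃ (f : ℤ × ℤ × ℤ → G) (ψ : G →* (ℤ × ℤ × ℤ → G)), (∀ g, ψ g 0 = g) ∧
        (∀ g, ψ g (0, 0, 1) = 1) ∧ ∀ g, SemidirectProduct.inl (ψ g) ∈ latticeSubgroup f) :
      ∃ (H : Type u) (_ : Group H), IsGeneratedByCard 4 H ∧
        M.ProductContains GroupVariety.abelian H ∧ GroupEmbeds G H := by
    obtain ⟨f, ψ, h0, -, hψ⟩ := h
    exact ⟨latticeSubgroup f, inferInstance, isGeneratedByCard_latticeSubgroup f,
      productContains hM _, groupEmbeds_latticeSubgroup h0 hψ⟩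
  have solvable {G : Type u} [Group G] (hl : HasDerivedLength G l)
      (h : ∃ (f : ℤ × ℤ × ℤ → G) (ψ : G →* (ℤ × ℤ × ℤ → G)), (∀ g, ψ g 0 = g) ∧
        (∀ g, ψ g (0, 0, 1) = 1) ∧ ∀ g, SemidirectProduct.inl (ψ g) ∈ latticeSubgroup f) :
      ∃ (H : Type u) (_ : Group H), IsGeneratedByCard 4 H ∧
        HasDerivedLength H (l + 1) ∧ GroupEmbeds G H := by
    obtain ⟨f, ψ, h0, h1, hψ⟩ := h
    exact ⟨latticeSubgroup f, inferInstance, isGeneratedByCard_latticeSubgroup f,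
      hasDerivedLength_latticeSubgroup hl h0 h1 hψ, groupEmbeds_latticeSubgroup h0 hψ⟩
  exact ⟨fun _ hM hA => variety hM (exists_latticeEmbedding_of_abelianization hA),
    fun hG hM => variety hM (exists_latticeEmbedding_of_fg hG),
    fun _ hl hA => solvable hl (exists_latticeEmbedding_of_abelianization hA),
    fun hG hl => solvable hl (exists_latticeEmbedding_of_fg hG)⟩
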